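/- Let $H$ and $H'$ be two regular hexagons of side length $1$ in the plane sharing a side; up to a congruence, $H$ is centred at $(0,0)$, $H'$ is centred at $(\sqrt3,0)$, and each has vertices at distance $1$ from its centre in the directions $\frac{\pi}{6}+\frac{k\pi}{3}$, $k=0,\dots,5$. Decompose each hexagon into three rhombuses of side $1$ and acute angle $\frac{\pi}{3}$, each spanned by the centre and the three consecutive vertices $k,k+1,k+2$, $k\in\{0,2,4\}$. Let $I$ and $J$ be the top rhombuses ($k=0$) of $H$ and $H'$, i.e. $I$ has vertices $(0,0),(\frac{\sqrt3}{2},\frac12),(0,1),(-\frac{\sqrt3}{2},\frac12)$ and $J=I+(\sqrt3,0)$; they meet only in a common acute vertex. Then for independent random points $X$, $Y$ uniformly distributed in $I$ and in $J$ respectively (or in the images of $I$ and $J$ under one isometry of the plane), the distance $|X-Y|$ has a probability density with respect to Lebesgue measure, which is the nonnegative function $$ f_{D_5}(d)=2d\begin{cases} \left(\frac13-\frac{\pi}{9\sqrt3}\right)d^2, & 0\le d\le 1,\\[4pt] -\frac{4d^2}{3\sqrt3}\sin^{-1}\frac{\sqrt3}{2d}+\left(\frac{\pi}{3\sqrt3}-1\right)d^2+\frac83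 d-\frac{\sqrt{4d^2-3}}{3}-1, & 1\le d\le\sqrt3,\\[4pt] \frac{4}{\sqrt3}\left(\frac{d^2}{3}-2\right)\sin^{-1}\frac{\sqrt3}{2d}+\left(\frac13-\frac{\pi}{9\sqrt3}\right)d^2+\frac83 d-\frac73\sqrt{4d^2-3}+\frac{4\pi}{3\sqrt3}+1, & \sqrt3\le d\le 2,\\[4pt] \frac{4}{\sqrt3}\left(\frac{d^2}{3}-2\right)\sin^{-1}\frac{\sqrt3}{2d}+\frac{2d^2}{3\sqrt3}\sin^{-1}\frac{\sqrt3}{d}+\left(1-\frac{\pi}{3\sqrt3}\right)d^2-\frac73\sqrt{4d^2-3}+\frac23\sqrt{d^2-3}+\frac{4\pi}{3\sqrt3}+3, & 2\le d\le\sqrt7,\\[4pt] \frac{2}{\sqrt3}\left(4-\frac{d^2}{3}\right)\sin^{-1}\frac{\sqrt3}{d}+\left(\frac{\pi}{9\sqrt3}-\frac13\right)d^2+2\sqrt{d^2-3}-\frac{4\pi}{3\sqrt3}-2, & \sqrt7\le d\le 2\sqrt3,\\[4pt] 0, & \text{otherwise.} \end{cases} $$ At the common endpoints of consecutive intervals the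 two formulas agree. -/

import Mathlib

open MeasureTheory ProbabilityTheory Set

noncomputable section

namespace HexRhombus

/-- The Euclidean plane. -/
abbrev Plane : Type := EuclideanSpace ℝ (Fin 2)

/-- The `k`-th vertex (counterclockwise, `k` modulo `6`) of the regular hexagon of side length `1`
centred at `c`, two of whose sides are vertical: `c + (cos (π/6 + k π/3), sin (π/6 + k π/3))`. -/
def hexVertex (c : Plane) (k : ℕ) : Plane :=
  c + !₂[Real.cos (Real.pi / 6 + k * (Real.pi / 3)), Real.sin (Real.pi / 6 + k * (Real.pi / 3))]

/-- The closed unit rhombus (side length `1`, acute angle `π/3`) spanned by the centre `c` of a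
unit hexagon and its three consecutive vertices `k`, `k + 1`, `k + 2`.  For `k = 0, 2, 4` these
are the three congruent rhombuses into which the hexagon is decomposed. -/
def unitRhombus (c : Plane) (k : ℕ) : Set Plane :=
  convexHull ℝ {c, hexVertex c k, hexVertex c (k + 1), hexVertex c (k + 2)}

/-- The centre of the left hexagon. -/
def centerLeft : Plane := !₂[0, 0]

/-- The centre of the right hexagon, which shares with the left one the side joining
`(√3/2, -1/2)` and `(√3/2, 1/2)`. -/
def centerRight : Plane := !₂[√3, 0]

/-- The rhombus `I`: the top rhombus of the left hexagon, with vertices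
`(0, 0)`, `(√3/2, 1/2)`, `(0, 1)`, `(-√3/2, 1/2)`. -/
def rhombusI : Set Plane := unitRhombus centerLeft 0

/-- The rhombus `J`: the top rhombus of the right hexagon, with vertices
`(√3, 0)`, `(3√3/2, 1/2)`, `(√3, 1)`, `(√3/2, 1/2)`.  It is the translate of `I` along its long
diagonal and meets `I` exactly in the acute vertex `(√3/2, 1/2)`. -/
def rhombusJ : Set Plane := unitRhombus centerRight 0

/-- The bracketed expression on `[0, 1]`. -/
def piece1 (d : ℝ) : ℝ :=
  (1 / 3 - Real.pi / (9 * √3)) * d ^ 2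

/-- The bracketed expression on `[1, √3]`. -/
def piece2 (d : ℝ) : ℝ :=
  -(4 * d ^ 2 / (3 * √3)) * Real.arcsin (√3 / (2 * d)) + (Real.pi / (3 * √3) - 1) * d ^ 2
    + 8 / 3 * d - √(4 * d ^ 2 - 3) / 3 - 1

/-- The bracketed expression on `[√3, 2]`. -/
def piece3 (d : ℝ) : ℝ :=
  4 / √3 * (d ^ 2 / 3 - 2) * Real.arcsin (√3 / (2 * d)) + (1 / 3 - Real.pi / (9 * √3)) * d ^ 2
    + 8 / 3 * d - 7 / 3 * √(4 * d ^ 2 - 3) + 4 * Real.pi / (3 * √3) + 1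

/-- The bracketed expression on `[2, √7]`. -/
def piece4 (d : ℝ) : ℝ :=
  4 / √3 * (d ^ 2 / 3 - 2) * Real.arcsin (√3 / (2 * d))
    + 2 * d ^ 2 / (3 * √3) * Real.arcsin (√3 / d) + (1 - Real.pi / (3 * √3)) * d ^ 2
    - 7 / 3 * √(4 * d ^ 2 - 3) + 2 / 3 * √(d ^ 2 - 3) + 4 * Real.pi / (3 * √3) + 3

/-- The bracketed expression on `[√7, 2√3]`. -/
def piece5 (d : ℝ) : ℝ :=
  2 / √3 * (4 - d ^ 2 / 3) * Real.arcsin (√3 / d) + (Real.pi / (9 * √3) - 1 / 3) * d ^ 2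
    + 2 * √(d ^ 2 - 3) - 4 * Real.pi / (3 * √3) - 2

/-- The five-piece density of the distance between uniform points of `I` and `J`. -/
def densityIJ (d : ℝ) : ℝ :=
  2 * d *
    (if d < 0 then 0
     else if d ≤ 1 then piece1 d
     else if d ≤ √3 then piece2 d
     else if d ≤ 2 then piece3 d
     else if d ≤ √7 then piece4 d
     else if d ≤ 2 * √3 then piece5 d
     else 0)

end HexRhombus

end

namespace HexRhombus

/-! Let `e₁`, `e₂` be the unit sides of `I` at the centre of its hexagon; they make an angle `2π/3`,
and `J` is `I` translated by `e₁ - e₂`. If `p`, `q` are the uniform coordinates of the two points in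
the unit square, their difference is `s e₁ - t e₂` with `s = 1 + q₁ - p₁` and `t = 1 + p₂ - q₂`.
Thus `s`, `t` are independent, each with the tent density `triangle` on `[0, 2]`, and the squared
distance is `s² + st + t²` (`lintegral_unitSquare_prod`, `dist_rhombusMap`). Passing to orthonormal
coordinates (Jacobian `2/√3`) and then to polar ones gives the density `(2d/√3) * angleIntegral d`
(`lintegral_sqrt_latticeForm`). Only the sector `|θ| ≤ π/6` counts, since elsewhere `s ≤ 0` or `t ≤
0`. Reflection in the axis swaps `s` and `t`, so half the sector suffices. For `θ` from `0` to
`π/6`, `s` increases from `d/√3` to `d` and `t` decreases from `d/√3` to `0`. The tents change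
formula at the levels `1` and `2`, whence the breakpoints: `d = 1` and `d = 2` (`s` reaches the
level at the edge `θ = π/6`), `√3` and `2√3` (`s = t` equals the level on the axis), and `√7` (`s =
2` and `t = 1` at the same angle, as `4 + 2 + 1 = 7`). Between breakpoints the integrand is
piecewise a polynomial in `s`, `t` with the explicit primitive `coordPrimitive`. -/

/-- The density of the sum of two independent uniform variables on `[0, 1]`. -/
noncomputable def triangle (s : ℝ) : ℝ := max 0 (1 - |s - 1|)

lemma triangle_nonneg (s : ℝ) : 0 ≤ triangle s := le_max_left _ _

@[fun_prop]
lemma continuous_triangle : Continuous triangle := by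
  unfold triangle; fun_prop

lemma triangle_of_le_one {s : ℝ} (h0 : 0 ≤ s) (h1 : s ≤ 1) : triangle s = s := by
  rw [triangle, abs_of_nonpos (by linarith), max_eq_right (by linarith)]; ring

lemma triangle_of_one_le {s : ℝ} (h1 : 1 ≤ s) (h2 : s ≤ 2) : triangle s = 2 - s := by
  rw [triangle, abs_of_nonneg (by linarith), max_eq_right (by linarith)]; ring

lemma triangle_of_two_le {s : ℝ} (h2 : 2 ≤ s) : triangle s = 0 := by
  rw [triangle, abs_of_nonneg (by linarith), max_eq_left (by linarith)]

lemma triangle_of_nonpos {s : ℝ} (h : s ≤ 0) : triangle s = 0 := by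
  rw [triangle, abs_of_nonpos (by linarith), max_eq_left (by linarith)]

/-! ### Lattice coordinates along a circle: sign and monotonicity in the angle. -/

/-- The first lattice coordinate of the vector of length `d` in direction `θ`. -/
noncomputable def fstCoord (d θ : ℝ) : ℝ := √3 / 3 * (d * Real.cos θ) + d * Real.sin θ

/-- The second lattice coordinate of the vector of length `d` in direction `θ`. -/
noncomputable def sndCoord (d θ : ℝ) : ℝ := √3 / 3 * (d * Real.cos θ) - d * Real.sin θ

/-- The amplitude-phase form, from which signs and monotonicity are read off the sine. -/
lemma fstCoord_eq (d θ : ℝ) : fstCoord d θ = 2 * √3 / 3 * d * Real.sin (Real.pi / 6 + θ) := by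
  have h : √3 * √3 = 3 := Real.mul_self_sqrt (by norm_num)
  rw [Real.sin_add, Real.sin_pi_div_six, Real.cos_pi_div_six, fstCoord]
  linear_combination (-(1 / 3) * d * Real.sin θ) * h

lemma sndCoord_neg (d θ : ℝ) : sndCoord d (-θ) = fstCoord d θ := by
  simp [sndCoord, fstCoord]

lemma fstCoord_neg (d θ : ℝ) : fstCoord d (-θ) = sndCoord d θ := by
  simp [sndCoord, fstCoord]; ring

@[fun_prop]
lemma continuous_fstCoord (d : ℝ) : Continuous (fstCoord d) := by
  unfold fstCoord; fun_prop

@[fun_prop]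
lemma continuous_sndCoord (d : ℝ) : Continuous (sndCoord d) := by
  unfold sndCoord; fun_prop

lemma fstCoord_nonneg {d θ : ℝ} (hd : 0 ≤ d) (h1 : -(Real.pi / 6) ≤ θ)
    (h2 : θ ≤ 5 * Real.pi / 6) : 0 ≤ fstCoord d θ := by
  rw [fstCoord_eq]
  have := Real.sin_nonneg_of_nonneg_of_le_pi (x := Real.pi / 6 + θ) (by linarith) (by linarith)
  positivity

lemma fstCoord_nonpos {d θ : ℝ} (hd : 0 ≤ d) (h1 : -Real.pi ≤ θ)
    (h2 : θ ≤ -(Real.pi / 6)) : fstCoord d θ ≤ 0 := by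
  rw [fstCoord_eq]
  have := Real.sin_nonpos_of_nonpos_of_neg_pi_le (x := Real.pi / 6 + θ) (by linarith)
    (by linarith [Real.pi_pos])
  exact mul_nonpos_of_nonneg_of_nonpos (by positivity) this

lemma fstCoord_mono {d θ θ' : ℝ} (hd : 0 ≤ d) (h1 : -(2 * Real.pi / 3) ≤ θ) (h : θ ≤ θ')
    (h2 : θ' ≤ Real.pi / 3) : fstCoord d θ ≤ fstCoord d θ' := by
  rw [fstCoord_eq, fstCoord_eq]
  have := Real.sin_le_sin_of_le_of_le_pi_div_two (x := Real.pi / 6 + θ) (y := Real.pi / 6 + θ')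
    (by linarith) (by linarith) (by linarith)
  gcongr

lemma sndCoord_anti {d θ θ' : ℝ} (hd : 0 ≤ d) (h1 : -(Real.pi / 3) ≤ θ) (h : θ ≤ θ')
    (h2 : θ' ≤ 2 * Real.pi / 3) : sndCoord d θ' ≤ sndCoord d θ := by
  rw [← fstCoord_neg, ← fstCoord_neg]
  exact fstCoord_mono hd (by linarith) (by linarith) (by linarith)

/-! ### The angular integral and its primitive. -/

/-- The angular part of the density of the difference of the two points. -/
noncomputable def angleIntegral (d : ℝ) : ℝ :=
  ∫ θ in (-(Real.pi / 6))..(Real.pi / 6), triangle (fstCoord d θ) * triangle (sndCoord d θ)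

lemma angleIntegral_nonneg (d : ℝ) : 0 ≤ angleIntegral d :=
  intervalIntegral.integral_nonneg (by linarith [Real.pi_pos])
    fun _ _ => mul_nonneg (triangle_nonneg _) (triangle_nonneg _)

lemma intervalIntegrable_triangle_mul (d x y : ℝ) : IntervalIntegrable
    (fun θ => triangle (fstCoord d θ) * triangle (sndCoord d θ)) volume x y :=
  Continuous.intervalIntegrable (by fun_prop) _ _

/-- The reflection `θ ↦ -θ` exchanges the two coordinates and so preserves the integrand. -/
lemma angleIntegral_eq_two_mul (d : ℝ) : angleIntegral d =
    2 * ∫ θ in (0)..(Real.pi / 6), triangle (fstCoord d θ) * triangle (sndCoord d θ) := by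
  rw [angleIntegral, ← intervalIntegral.integral_add_adjacent_intervals (b := 0)
    (intervalIntegrable_triangle_mul _ _ _) (intervalIntegrable_triangle_mul _ _ _), two_mul]
  congr 1
  rw [← neg_zero, ← intervalIntegral.integral_comp_neg]
  simp only [neg_zero, fstCoord_neg, sndCoord_neg, mul_comm]

/-- A primitive in `θ` of `a + b s + c t + e s t`, where `s` and `t` are the two coordinates. -/
noncomputable def coordPrimitive (a b c e d θ : ℝ) : ℝ :=
  a * θ + b * (√3 / 3 * (d * Real.sin θ) - d * Real.cos θ)
    + c * (√3 / 3 * (d * Real.sin θ) + d * Real.cos θ)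
    + e / 3 * (2 * (d * Real.sin θ) * (d * Real.cos θ) - d ^ 2 * θ)

lemma hasDerivAt_coordPrimitive (a b c e d θ : ℝ) :
    HasDerivAt (coordPrimitive a b c e d)
      (a + b * fstCoord d θ + c * sndCoord d θ + e * (fstCoord d θ * sndCoord d θ)) θ := by
  have hs := (Real.hasDerivAt_sin θ).const_mul d
  have hc := (Real.hasDerivAt_cos θ).const_mul d
  have hi := hasDerivAt_id θ
  have h3 : √3 * √3 = 3 := Real.mul_self_sqrt (by norm_num)
  have key := (((hi.const_mul a).add (((hs.const_mul (√3 / 3)).sub hc).const_mul b)).add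
    (((hs.const_mul (√3 / 3)).add hc).const_mul c)).add
    ((((hs.const_mul 2).mul hc).sub (hi.const_mul (d ^ 2))).const_mul (e / 3))
  refine HasDerivAt.congr_deriv (f := coordPrimitive a b c e d) key ?_
  simp only [fstCoord, sndCoord]
  linear_combination -(e * d ^ 2 * Real.cos θ ^ 2 / 9) * h3
    + e / 3 * d ^ 2 * Real.sin_sq_add_cos_sq θ

/-- Each tent is affine between its breakpoints, so on a suitable range of angles the product has
this form: `s t` is `(0, 0, 0, 1)`, `(2 - s) t` is `(0, 0, 2, -1)`, and `(2 - s)(2 - t)` is `(4, -2,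
-2, 1)`. -/
lemma integral_triangle_mul {a b c e d x y : ℝ} (hxy : x ≤ y)
    (h : ∀ θ ∈ Icc x y, triangle (fstCoord d θ) * triangle (sndCoord d θ) =
      a + b * fstCoord d θ + c * sndCoord d θ + e * (fstCoord d θ * sndCoord d θ)) :
    ∫ θ in x..y, triangle (fstCoord d θ) * triangle (sndCoord d θ) =
      coordPrimitive a b c e d y - coordPrimitive a b c e d x := by
  rw [intervalIntegral.integral_congr (g := fun θ =>
    a + b * fstCoord d θ + c * sndCoord d θ + e * (fstCoord d θ * sndCoord d θ))]
  · exact intervalIntegral.integral_eq_sub_of_hasDerivAt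
      (fun θ _ => hasDerivAt_coordPrimitive a b c e d θ)
      (Continuous.intervalIntegrable (by fun_prop) _ _)
  · rw [uIcc_of_le hxy]; exact h

/-! ### Angles at which a coordinate crosses a breakpoint of the tent. -/

/-- The trigonometric values at the angle where the first coordinate attains the level `c`. -/
lemma mul_sin_cos_arcsin_sub {c d : ℝ} (hc : 0 ≤ c) (hd : 0 < d) (h : √3 * c ≤ 2 * d) :
    d * Real.sin (Real.arcsin (√3 * c / (2 * d)) - Real.pi / 6)
        = (3 * c - √(4 * d ^ 2 - 3 * c ^ 2)) / 4 ∧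
      d * Real.cos (Real.arcsin (√3 * c / (2 * d)) - Real.pi / 6)
        = √3 * (c + √(4 * d ^ 2 - 3 * c ^ 2)) / 4 := by
  have h3 : √3 * √3 = 3 := Real.mul_self_sqrt (by norm_num)
  have hs : Real.sin (Real.arcsin (√3 * c / (2 * d))) = √3 * c / (2 * d) :=
    Real.sin_arcsin (by have : 0 ≤ √3 * c / (2 * d) := by positivity
                        linarith) ((div_le_one (by positivity)).2 h)
  have hcos : Real.cos (Real.arcsin (√3 * c / (2 * d))) = √(4 * d ^ 2 - 3 * c ^ 2) / (2 * d) := by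
    rw [Real.cos_arcsin, eq_div_iff (by positivity)]
    nth_rw 2 [← Real.sqrt_sq (show (0 : ℝ) ≤ 2 * d by positivity)]
    rw [← Real.sqrt_mul' _ (by positivity)]
    congr 1
    field_simp
    linear_combination (-c ^ 2) * h3
  rw [Real.sin_sub, Real.cos_sub, hs, hcos, Real.sin_pi_div_six, Real.cos_pi_div_six]
  constructor
  · field_simp
    linear_combination 4 * c * h3
  · field_simp
    ring

lemma fstCoord_arcsin_sub {c d : ℝ} (hc : 0 ≤ c) (hd : 0 < d) (h : √3 * c ≤ 2 * d) :
    fstCoord d (Real.arcsin (√3 * c / (2 * d)) - Real.pi / 6) = c := by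
  have h3 : √3 * √3 = 3 := Real.mul_self_sqrt (by norm_num)
  obtain ⟨h1, h2⟩ := mul_sin_cos_arcsin_sub hc hd h
  rw [fstCoord, h1, h2]
  linear_combination ((c + √(4 * d ^ 2 - 3 * c ^ 2)) / 12) * h3

/-- The angle at which the first coordinate attains the level `c`. -/
noncomputable def levelAngle (c d : ℝ) : ℝ := Real.arcsin (√3 * c / (2 * d)) - Real.pi / 6

lemma levelAngle_le {c d : ℝ} (hd : 0 < d) (h : c ≤ d) : levelAngle c d ≤ Real.pi / 6 := by
  have : Real.arcsin (√3 * c / (2 * d)) ≤ Real.pi / 3 := by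
    rw [Real.arcsin_le_iff_le_sin' ⟨by linarith [Real.pi_pos], by linarith [Real.pi_pos]⟩,
      Real.sin_pi_div_three, div_le_div_iff₀ (by positivity) (by positivity)]
    nlinarith [mul_le_mul_of_nonneg_left h (Real.sqrt_nonneg 3)]
  rw [levelAngle]; linarith

lemma levelAngle_nonneg {c d : ℝ} (hd : 0 < d) (h : d ≤ √3 * c) : 0 ≤ levelAngle c d := by
  have : Real.pi / 6 ≤ Real.arcsin (√3 * c / (2 * d)) := by
    rw [Real.le_arcsin_iff_sin_le' ⟨by linarith [Real.pi_pos], by linarith [Real.pi_pos]⟩,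
      Real.sin_pi_div_six, div_le_div_iff₀ (by positivity) (by positivity)]
    linarith
  rw [levelAngle]; linarith

lemma levelAngle_nonpos {c d : ℝ} (hd : 0 < d) (h : √3 * c ≤ d) : levelAngle c d ≤ 0 := by
  have : Real.arcsin (√3 * c / (2 * d)) ≤ Real.pi / 6 := by
    rw [Real.arcsin_le_iff_le_sin' ⟨by linarith [Real.pi_pos], by linarith [Real.pi_pos]⟩,
      Real.sin_pi_div_six, div_le_div_iff₀ (by positivity) (by positivity)]
    linarith
  rw [levelAngle]; linarith

lemma neg_levelAngle_le {c d : ℝ} (hc : 0 ≤ c) (hd : 0 < d) : -levelAngle c d ≤ Real.pi / 6 := by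
  have : 0 ≤ Real.arcsin (√3 * c / (2 * d)) := Real.arcsin_nonneg.2 (by positivity)
  rw [levelAngle]; linarith

lemma sndCoord_levelAngle {c d : ℝ} (hc : 0 ≤ c) (hd : 0 < d) (h : √3 * c ≤ 2 * d) :
    sndCoord d (levelAngle c d) = (√(4 * d ^ 2 - 3 * c ^ 2) - c) / 2 := by
  have h3 : √3 * √3 = 3 := Real.mul_self_sqrt (by norm_num)
  obtain ⟨h1, h2⟩ := mul_sin_cos_arcsin_sub hc hd h
  rw [sndCoord, levelAngle, h1, h2]
  linear_combination ((c + √(4 * d ^ 2 - 3 * c ^ 2)) / 12) * h3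

lemma fstCoord_pi_div_six (d : ℝ) : fstCoord d (Real.pi / 6) = d := by
  have h3 : √3 * √3 = 3 := Real.mul_self_sqrt (by norm_num)
  rw [fstCoord, Real.sin_pi_div_six, Real.cos_pi_div_six]
  linear_combination (d / 6) * h3

lemma coord_bounds {d θ : ℝ} (hd : 0 ≤ d) (h0 : 0 ≤ θ) (h1 : θ ≤ Real.pi / 6) :
    0 ≤ sndCoord d θ ∧ sndCoord d θ ≤ fstCoord d θ ∧ fstCoord d θ ≤ d := by
  refine ⟨?_, ?_, ?_⟩
  · rw [← fstCoord_neg]; exact fstCoord_nonneg hd (by linarith) (by linarith)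
  · rw [← fstCoord_neg]
    exact fstCoord_mono hd (by linarith) (by linarith) (by linarith)
  · calc fstCoord d θ ≤ fstCoord d (Real.pi / 6) :=
        fstCoord_mono hd (by linarith) h1 (by linarith)
      _ = d := fstCoord_pi_div_six d

lemma levelAngle_one (d : ℝ) :
    levelAngle 1 d = Real.arcsin (√3 / (2 * d)) - Real.pi / 6 := by
  rw [levelAngle, mul_one]

lemma levelAngle_two (d : ℝ) : levelAngle 2 d = Real.arcsin (√3 / d) - Real.pi / 6 := by
  rw [levelAngle, mul_comm 2 d, mul_div_mul_right _ _ two_ne_zero]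

lemma sin_cos_levelAngle_one {d : ℝ} (hd : 1 ≤ d) :
    d * Real.sin (levelAngle 1 d) = (3 - √(4 * d ^ 2 - 3)) / 4 ∧
      d * Real.cos (levelAngle 1 d) = √3 * (1 + √(4 * d ^ 2 - 3)) / 4 := by
  have hr : √3 ≤ 2 := Real.sqrt_le_iff.2 ⟨by norm_num, by norm_num⟩
  simpa [levelAngle] using
    mul_sin_cos_arcsin_sub (c := 1) (d := d) zero_le_one (by linarith) (by linarith)

lemma sin_cos_levelAngle_two {d : ℝ} (hd : 2 ≤ d) :
    d * Real.sin (levelAngle 2 d) = (3 - √(d ^ 2 - 3)) / 2 ∧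
      d * Real.cos (levelAngle 2 d) = √3 * (1 + √(d ^ 2 - 3)) / 2 := by
  have hr : √3 ≤ 2 := Real.sqrt_le_iff.2 ⟨by norm_num, by norm_num⟩
  have h := mul_sin_cos_arcsin_sub (c := 2) (d := d) zero_le_two (by linarith) (by linarith)
  have hw : √(4 * d ^ 2 - 3 * 2 ^ 2) = 2 * √(d ^ 2 - 3) := by
    rw [show 4 * d ^ 2 - 3 * 2 ^ 2 = 2 ^ 2 * (d ^ 2 - 3) by ring,
      Real.sqrt_mul (by norm_num), Real.sqrt_sq (by norm_num)]
  rw [hw] at h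
  rw [levelAngle]
  exact ⟨h.1.trans (by ring), h.2.trans (by ring)⟩

/-! ### Evaluation of the angular integral on each range of distances. -/

lemma angleIntegral_piece1 {d : ℝ} (h0 : 0 ≤ d) (h1 : d ≤ 1) :
    angleIntegral d = √3 * piece1 d := by
  have hπ := Real.pi_pos
  have h3 : √3 * √3 = 3 := Real.mul_self_sqrt (by norm_num)
  -- Rationalising the denominators leaves an identity polynomial in `√3`.
  have hinv : Real.pi / (9 * √3) = Real.pi * √3 / 27 := by field_simp; linear_combination -9 * h3
  rw [angleIntegral_eq_two_mul,
    integral_triangle_mul (a := 0) (b := 0) (c := 0) (e := 1) (by positivity)]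
  · rw [coordPrimitive, coordPrimitive, piece1, Real.sin_pi_div_six, Real.cos_pi_div_six, hinv]
    simp only [Real.sin_zero, Real.cos_zero]
    linear_combination (Real.pi * d ^ 2 / 27) * h3
  · rintro θ ⟨ht0, ht1⟩
    obtain ⟨b1, b2, b3⟩ := coord_bounds h0 ht0 ht1
    rw [triangle_of_le_one (by linarith) (by linarith), triangle_of_le_one b1 (by linarith)]
    ring

/-- The integrand is `s t` until `s` reaches `1`, and `(2 - s) t` afterwards; `t` stays below `1`
because `t ≤ d/√3 ≤ 1` on the axis. -/
lemma angleIntegral_piece2 {d : ℝ} (h1 : 1 ≤ d) (h2 : d ≤ √3) :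
    angleIntegral d = √3 * piece2 d := by
  have hπ := Real.pi_pos
  have h3 : √3 * √3 = 3 := Real.mul_self_sqrt (by norm_num)
  have hr : √3 ≤ 2 := Real.sqrt_le_iff.2 ⟨by norm_num, by norm_num⟩
  have hd : 0 < d := by linarith
  have hw : √(4 * d ^ 2 - 3) ^ 2 = 4 * d ^ 2 - 3 := Real.sq_sqrt (by nlinarith)
  have hw3 : √(4 * d ^ 2 - 3) ≤ 3 := Real.sqrt_le_iff.2 ⟨by norm_num, by nlinarith⟩
  have hinv1 : 4 * d ^ 2 / (3 * √3) = 4 * d ^ 2 * √3 / 9 := by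
    field_simp; linear_combination -3 * h3
  have hinv2 : Real.pi / (3 * √3) = Real.pi * √3 / 9 := by field_simp; linear_combination -3 * h3
  have hl0 : 0 ≤ levelAngle 1 d := levelAngle_nonneg hd (by linarith)
  have hl1 : levelAngle 1 d ≤ Real.pi / 6 := levelAngle_le hd h1
  have hfst : fstCoord d (levelAngle 1 d) = 1 := fstCoord_arcsin_sub zero_le_one hd (by linarith)
  have hsnd := sndCoord_levelAngle (c := 1) zero_le_one hd (by linarith)
  simp only [one_pow, mul_one] at hsnd
  obtain ⟨hs, hc⟩ := sin_cos_levelAngle_one h1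
  rw [angleIntegral_eq_two_mul, ← intervalIntegral.integral_add_adjacent_intervals
      (b := levelAngle 1 d) (intervalIntegrable_triangle_mul _ _ _)
      (intervalIntegrable_triangle_mul _ _ _),
    integral_triangle_mul (a := 0) (b := 0) (c := 0) (e := 1) hl0,
    integral_triangle_mul (a := 0) (b := 0) (c := 2) (e := -1) hl1]
  · simp only [coordPrimitive]
    rw [hs, hc, levelAngle_one, piece2, Real.sin_pi_div_six, Real.cos_pi_div_six, hinv1, hinv2,
      Real.sin_zero, Real.cos_zero]
    -- What remains is a polynomial identity modulo `r * r = 3` and `w ^ 2 = 4 * d ^ 2 - 3`, with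
    -- the arcsine and `π` as atoms.
    generalize √(4 * d ^ 2 - 3) = w at *
    generalize √3 = r at *
    grind
  · rintro θ ⟨ht0, ht1⟩
    obtain ⟨b1, b2, b3⟩ := coord_bounds hd.le (hl0.trans ht0) ht1
    have m1 := fstCoord_mono (θ := levelAngle 1 d) (θ' := θ) hd.le (by linarith) ht0 (by linarith)
    have m2 := sndCoord_anti (θ := levelAngle 1 d) (θ' := θ) hd.le (by linarith) ht0 (by linarith)
    rw [triangle_of_one_le (by linarith) (by linarith), triangle_of_le_one b1 (by linarith)]
    ring
  · rintro θ ⟨ht0, ht1⟩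
    obtain ⟨b1, b2, b3⟩ := coord_bounds hd.le ht0 (ht1.trans hl1)
    have m1 := fstCoord_mono (θ' := levelAngle 1 d) (θ := θ) hd.le (by linarith) ht1 (by linarith)
    rw [triangle_of_le_one (by linarith) (by linarith), triangle_of_le_one b1 (by linarith)]
    ring

/-- Both coordinates now start at `d/√3 ≥ 1`, so the switch occurs where `t` falls to `1`. By
reflection that angle is `-levelAngle 1 d`. -/
lemma angleIntegral_piece3 {d : ℝ} (h1 : √3 ≤ d) (h2 : d ≤ 2) :
    angleIntegral d = √3 * piece3 d := by
  have hπ := Real.pi_pos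
  have h3 : √3 * √3 = 3 := Real.mul_self_sqrt (by norm_num)
  have hr : 1 ≤ √3 := Real.one_le_sqrt.2 (by norm_num)
  have hd : 0 < d := by linarith
  have hd2 : 3 ≤ d ^ 2 := by nlinarith
  have hw : √(4 * d ^ 2 - 3) ^ 2 = 4 * d ^ 2 - 3 := Real.sq_sqrt (by nlinarith)
  have hw3 : 3 ≤ √(4 * d ^ 2 - 3) := Real.le_sqrt_of_sq_le (by linarith)
  have hinv1 : 4 / √3 = 4 * √3 / 3 := by field_simp; linear_combination -h3
  have hinv2 : Real.pi / (9 * √3) = Real.pi * √3 / 27 := by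
    field_simp; linear_combination -9 * h3
  have hinv3 : 4 * Real.pi / (3 * √3) = 4 * Real.pi * √3 / 9 := by
    field_simp; linear_combination -3 * h3
  have hl0 : 0 ≤ -levelAngle 1 d :=
    neg_nonneg.2 (levelAngle_nonpos hd (by linarith))
  have hl1 : -levelAngle 1 d ≤ Real.pi / 6 := neg_levelAngle_le zero_le_one hd
  have hsnd : sndCoord d (-levelAngle 1 d) = 1 := by
    rw [sndCoord_neg]; exact fstCoord_arcsin_sub zero_le_one hd (by linarith)
  have hfst := sndCoord_levelAngle (c := 1) zero_le_one hd (by linarith)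
  rw [← fstCoord_neg] at hfst
  simp only [one_pow, mul_one] at hfst
  obtain ⟨hs, hc⟩ := sin_cos_levelAngle_one (d := d) (by linarith)
  rw [angleIntegral_eq_two_mul, ← intervalIntegral.integral_add_adjacent_intervals
      (b := -levelAngle 1 d) (intervalIntegrable_triangle_mul _ _ _)
      (intervalIntegrable_triangle_mul _ _ _),
    integral_triangle_mul (a := 4) (b := -2) (c := -2) (e := 1) hl0,
    integral_triangle_mul (a := 0) (b := 0) (c := 2) (e := -1) hl1]
  · simp only [coordPrimitive, Real.sin_neg, Real.cos_neg, mul_neg]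
    rw [hs, hc, levelAngle_one, piece3, Real.sin_pi_div_six, Real.cos_pi_div_six, hinv1, hinv2,
      hinv3, Real.sin_zero, Real.cos_zero]
    generalize √(4 * d ^ 2 - 3) = w at *
    generalize √3 = r at *
    grind
  · rintro θ ⟨ht0, ht1⟩
    obtain ⟨b1, b2, b3⟩ := coord_bounds hd.le (hl0.trans ht0) ht1
    have m1 := fstCoord_mono (θ := -levelAngle 1 d) (θ' := θ) hd.le (by linarith) ht0 (by linarith)
    have m2 := sndCoord_anti (θ := -levelAngle 1 d) (θ' := θ) hd.le (by linarith) ht0 (by linarith)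
    rw [triangle_of_one_le (by linarith) (by linarith), triangle_of_le_one b1 (by linarith)]
    ring
  · rintro θ ⟨ht0, ht1⟩
    obtain ⟨b1, b2, b3⟩ := coord_bounds hd.le ht0 (ht1.trans hl1)
    have m2 := sndCoord_anti (θ' := -levelAngle 1 d) (θ := θ) hd.le (by linarith) ht1 (by linarith)
    rw [triangle_of_one_le (by linarith) (by linarith),
      triangle_of_one_le (by linarith) (by linarith)]
    ring

/-- Where `t` falls to `1`, `s` is still at most `2`; as `s` increases, it reaches `2` no earlier.
This fixes the order of the two switches on `[2, √7]`. -/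
lemma neg_levelAngle_one_le_levelAngle_two {d : ℝ} (h1 : 2 ≤ d) (h2 : d ≤ √7) :
    -levelAngle 1 d ≤ levelAngle 2 d := by
  have hπ := Real.pi_pos
  have hr : √3 ≤ 2 := Real.sqrt_le_iff.2 ⟨by norm_num, by norm_num⟩
  have hd : 0 < d := by linarith
  have hd7 : d ^ 2 ≤ 7 := (Real.le_sqrt hd.le (by norm_num)).1 h2
  -- When `t = 1`, `s = (√(4d² - 3) - 1) / 2`, so the bound `5` is exactly `s ≤ 2`.
  have hw : √(4 * d ^ 2 - 3) ≤ 5 := Real.sqrt_le_iff.2 ⟨by norm_num, by linarith⟩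
  have hfst := sndCoord_levelAngle (c := 1) zero_le_one hd (by linarith)
  rw [← fstCoord_neg] at hfst
  simp only [one_pow, mul_one] at hfst
  have hl := neg_levelAngle_le (c := 1) zero_le_one hd
  have hl' := levelAngle_nonpos (c := 1) hd (by linarith)
  suffices Real.pi / 6 + -levelAngle 1 d ≤ Real.arcsin (√3 * 2 / (2 * d)) by
    rw [levelAngle.eq_1 2]; linarith
  rw [Real.le_arcsin_iff_sin_le' ⟨by linarith, by linarith⟩, le_div_iff₀ (by positivity)]
  rw [fstCoord_eq] at hfst
  have h3 : √3 * √3 = 3 := Real.mul_self_sqrt (by norm_num)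
  nlinarith [Real.sqrt_nonneg 3]

/-- Three ranges of angles: `(2 - s)(2 - t)` until `t` falls to `1`, then `(2 - s) t` until `s`
reaches `2`, then zero. -/
lemma angleIntegral_piece4 {d : ℝ} (h1 : 2 ≤ d) (h2 : d ≤ √7) :
    angleIntegral d = √3 * piece4 d := by
  have hπ := Real.pi_pos
  have h3 : √3 * √3 = 3 := Real.mul_self_sqrt (by norm_num)
  have hr : 1 ≤ √3 := Real.one_le_sqrt.2 (by norm_num)
  have hr2 : √3 ≤ 2 := Real.sqrt_le_iff.2 ⟨by norm_num, by norm_num⟩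
  have hr7 : √7 ≤ 3 := Real.sqrt_le_iff.2 ⟨by norm_num, by norm_num⟩
  have hd : 0 < d := by linarith
  have hd2 : 4 ≤ d ^ 2 := by nlinarith
  have hd23 : d ≤ √3 * 2 := by nlinarith
  have hw : √(4 * d ^ 2 - 3) ^ 2 = 4 * d ^ 2 - 3 := Real.sq_sqrt (by nlinarith)
  have hz : √(d ^ 2 - 3) ^ 2 = d ^ 2 - 3 := Real.sq_sqrt (by nlinarith)
  have hw3 : 3 ≤ √(4 * d ^ 2 - 3) := Real.le_sqrt_of_sq_le (by linarith)
  have hinv1 : 4 / √3 = 4 * √3 / 3 := by field_simp; linear_combination -h3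
  have hinv2 : Real.pi / (3 * √3) = Real.pi * √3 / 9 := by field_simp; linear_combination -3 * h3
  have hinv3 : 4 * Real.pi / (3 * √3) = 4 * Real.pi * √3 / 9 := by
    field_simp; linear_combination -3 * h3
  have hinv4 : 2 * d ^ 2 / (3 * √3) = 2 * d ^ 2 * √3 / 9 := by
    field_simp; linear_combination -3 * h3
  have hl0 : 0 ≤ -levelAngle 1 d :=
    neg_nonneg.2 (levelAngle_nonpos hd (by linarith))
  have hl1 : -levelAngle 1 d ≤ levelAngle 2 d := neg_levelAngle_one_le_levelAngle_two h1 h2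
  have hl2 : levelAngle 2 d ≤ Real.pi / 6 := levelAngle_le hd h1
  have hsnd : sndCoord d (-levelAngle 1 d) = 1 := by
    rw [sndCoord_neg]; exact fstCoord_arcsin_sub zero_le_one hd (by linarith)
  have hfst := sndCoord_levelAngle (c := 1) zero_le_one hd (by linarith)
  rw [← fstCoord_neg] at hfst
  simp only [one_pow, mul_one] at hfst
  have hfst2 : fstCoord d (levelAngle 2 d) = 2 := fstCoord_arcsin_sub zero_le_two hd (by linarith)
  obtain ⟨hs, hc⟩ := sin_cos_levelAngle_one (d := d) (by linarith)
  obtain ⟨hs2, hc2⟩ := sin_cos_levelAngle_two h1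
  rw [angleIntegral_eq_two_mul, ← intervalIntegral.integral_add_adjacent_intervals
      (b := levelAngle 2 d) (intervalIntegrable_triangle_mul _ _ _)
      (intervalIntegrable_triangle_mul _ _ _),
    ← intervalIntegral.integral_add_adjacent_intervals (c := levelAngle 2 d)
      (b := -levelAngle 1 d) (intervalIntegrable_triangle_mul _ _ _)
      (intervalIntegrable_triangle_mul _ _ _),
    integral_triangle_mul (a := 4) (b := -2) (c := -2) (e := 1) hl0,
    integral_triangle_mul (a := 0) (b := 0) (c := 2) (e := -1) hl1,
    integral_triangle_mul (a := 0) (b := 0) (c := 0) (e := 0) hl2]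
  · simp only [coordPrimitive, Real.sin_neg, Real.cos_neg, mul_neg]
    rw [hs, hc, hs2, hc2, levelAngle_one, levelAngle_two, piece4, hinv1, hinv2,
      hinv3, hinv4, Real.sin_zero, Real.cos_zero]
    generalize √(4 * d ^ 2 - 3) = w at *
    generalize √(d ^ 2 - 3) = z at *
    generalize Real.arcsin (√3 / (2 * d)) = α
    generalize Real.arcsin (√3 / d) = β
    generalize √3 = r at *
    clear hinv1 hinv2 hinv3 hinv4 hs hc hs2 hc2 hfst hfst2 hsnd hl0 hl1 hl2
    grind
  · rintro θ ⟨ht0, ht1⟩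
    have m1 := fstCoord_mono (θ := levelAngle 2 d) (θ' := θ) hd.le (by linarith) ht0 (by linarith)
    rw [triangle_of_two_le (by linarith)]
    ring
  · rintro θ ⟨ht0, ht1⟩
    obtain ⟨b1, b2, b3⟩ := coord_bounds hd.le (hl0.trans ht0) (ht1.trans hl2)
    have m1 := fstCoord_mono (θ := -levelAngle 1 d) (θ' := θ) hd.le (by linarith) ht0 (by linarith)
    have m3 := fstCoord_mono (θ := θ) (θ' := levelAngle 2 d) hd.le (by linarith) ht1 (by linarith)
    have m2 := sndCoord_anti (θ := -levelAngle 1 d) (θ' := θ) hd.le (by linarith) ht0 (by linarith)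
    rw [triangle_of_one_le (by linarith) (by linarith), triangle_of_le_one b1 (by linarith)]
    ring
  · rintro θ ⟨ht0, ht1⟩
    obtain ⟨b1, b2, b3⟩ := coord_bounds hd.le ht0 (ht1.trans (hl1.trans hl2))
    have m2 := sndCoord_anti (θ' := -levelAngle 1 d) (θ := θ) hd.le (by linarith) ht1 (by linarith)
    have m3 := fstCoord_mono (θ := θ) (θ' := levelAngle 2 d) hd.le (by linarith) (ht1.trans hl1)
      (by linarith)
    rw [triangle_of_one_le (by linarith) (by linarith),
      triangle_of_one_le (by linarith) (by linarith)]
    ring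

/-- Now `s` reaches `2` while `t` is still at least `1`, so the integrand passes from `(2 - s)(2 -
t)` directly to zero. -/
lemma angleIntegral_piece5 {d : ℝ} (h1 : √7 ≤ d) (h2 : d ≤ 2 * √3) :
    angleIntegral d = √3 * piece5 d := by
  have hπ := Real.pi_pos
  have h3 : √3 * √3 = 3 := Real.mul_self_sqrt (by norm_num)
  have hr2 : √3 ≤ 2 := Real.sqrt_le_iff.2 ⟨by norm_num, by norm_num⟩
  have hr7 : 2 ≤ √7 := Real.le_sqrt_of_sq_le (by norm_num)
  have hd : 0 < d := by linarith
  have hd2 : 7 ≤ d ^ 2 := (Real.sqrt_le_left hd.le).1 h1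
  have hz : √(d ^ 2 - 3) ^ 2 = d ^ 2 - 3 := Real.sq_sqrt (by nlinarith)
  have hinv1 : 2 / √3 = 2 * √3 / 3 := by field_simp; linear_combination -h3
  have hinv2 : Real.pi / (9 * √3) = Real.pi * √3 / 27 := by
    field_simp; linear_combination -9 * h3
  have hinv3 : 4 * Real.pi / (3 * √3) = 4 * Real.pi * √3 / 9 := by
    field_simp; linear_combination -3 * h3
  have hl0 : 0 ≤ levelAngle 2 d := levelAngle_nonneg hd (by linarith)
  have hl1 : levelAngle 2 d ≤ Real.pi / 6 := levelAngle_le hd (by linarith)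
  have hsnd : 1 ≤ sndCoord d (levelAngle 2 d) := by
    -- Equivalent to `d² ≥ 7`; it gives `t ≥ (4 - 2) / 2 = 1` where `s = 2`.
    have h4 : 4 ≤ √(4 * d ^ 2 - 3 * 2 ^ 2) := Real.le_sqrt_of_sq_le (by linarith)
    rw [sndCoord_levelAngle zero_le_two hd (by linarith)]
    generalize √(4 * d ^ 2 - 3 * 2 ^ 2) = w at *
    linarith
  have hfst : fstCoord d (levelAngle 2 d) = 2 := fstCoord_arcsin_sub zero_le_two hd (by linarith)
  obtain ⟨hs, hc⟩ := sin_cos_levelAngle_two (d := d) (by linarith)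
  rw [angleIntegral_eq_two_mul, ← intervalIntegral.integral_add_adjacent_intervals
      (b := levelAngle 2 d) (intervalIntegrable_triangle_mul _ _ _)
      (intervalIntegrable_triangle_mul _ _ _),
    integral_triangle_mul (a := 4) (b := -2) (c := -2) (e := 1) hl0,
    integral_triangle_mul (a := 0) (b := 0) (c := 0) (e := 0) hl1]
  · simp only [coordPrimitive]
    rw [hs, hc, levelAngle_two, piece5, hinv1, hinv2, hinv3, Real.sin_zero, Real.cos_zero]
    generalize √(d ^ 2 - 3) = z at *
    generalize √3 = r at *
    grind
  · rintro θ ⟨ht0, ht1⟩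
    have m1 := fstCoord_mono (θ := levelAngle 2 d) (θ' := θ) hd.le (by linarith) ht0 (by linarith)
    rw [triangle_of_two_le (by linarith)]
    ring
  · rintro θ ⟨ht0, ht1⟩
    obtain ⟨b1, b2, b3⟩ := coord_bounds hd.le ht0 (ht1.trans hl1)
    have m2 := sndCoord_anti (θ' := levelAngle 2 d) (θ := θ) hd.le (by linarith) ht1 (by linarith)
    have m3 := fstCoord_mono (θ := θ) (θ' := levelAngle 2 d) hd.le (by linarith) ht1
      (by linarith)
    rw [triangle_of_one_le (by linarith) (by linarith),
      triangle_of_one_le (by linarith) (by linarith)]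
    ring

/-- Already on the axis `s = d/√3 ≥ 2`, and `s` only grows from there. -/
lemma angleIntegral_of_le {d : ℝ} (h : 2 * √3 ≤ d) : angleIntegral d = 0 := by
  have hπ := Real.pi_pos
  have h3 : √3 * √3 = 3 := Real.mul_self_sqrt (by norm_num)
  have hd : 0 < d := lt_of_lt_of_le (by positivity) h
  rw [angleIntegral_eq_two_mul,
    integral_triangle_mul (a := 0) (b := 0) (c := 0) (e := 0) (by positivity)]
  · simp [coordPrimitive]
  · rintro θ ⟨ht0, ht1⟩
    have m1 := fstCoord_mono (θ := 0) (θ' := θ) hd.le (by linarith) ht0 (by linarith)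
    have : fstCoord d 0 = √3 / 3 * d := by simp [fstCoord]
    rw [triangle_of_two_le (by nlinarith [Real.sqrt_nonneg 3])]
    ring

/-! ### The piecewise formula as an angular integral. -/

lemma densityIJ_of_nonneg {d : ℝ} (hd : 0 ≤ d) :
    densityIJ d = 2 * d * (angleIntegral d / √3) := by
  have h3 : √3 ≠ 0 := by positivity
  have key {p : ℝ} (h : angleIntegral d = √3 * p) : p = angleIntegral d / √3 := by
    rw [h, mul_div_cancel_left₀ _ h3]
  unfold densityIJ
  congr 1
  split_ifs with h0 h1 h2 h3 h4 h5
  · linarith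
  · exact key (angleIntegral_piece1 hd h1)
  · exact key (angleIntegral_piece2 (by linarith) h2)
  · exact key (angleIntegral_piece3 (by linarith) h3)
  · exact key (angleIntegral_piece4 (by linarith) h4)
  · exact key (angleIntegral_piece5 (by linarith) h5)
  · rw [angleIntegral_of_le (by linarith), zero_div]

lemma densityIJ_of_neg {d : ℝ} (hd : d < 0) : densityIJ d = 0 := by
  simp [densityIJ, hd]

/-- Every piece is evaluated on a closed interval against the same integral, so neighbouring
formulas agree at common endpoints without further computation. -/
lemma densityIJ_of_angleIntegral_eq {d p : ℝ} (hd : 0 ≤ d) (h : angleIntegral d = √3 * p) :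
    densityIJ d = 2 * d * p := by
  rw [densityIJ_of_nonneg hd, h, mul_div_cancel_left₀ _ (by positivity)]

lemma densityIJ_nonneg (d : ℝ) : 0 ≤ densityIJ d := by
  rcases lt_or_ge d 0 with hd | hd
  · rw [densityIJ_of_neg hd]
  · rw [densityIJ_of_nonneg hd]
    have := angleIntegral_nonneg d
    positivity

/-! ### Triangular laws from uniform points of the unit square. -/

lemma min_sub_max_eq_one_sub_abs (t : ℝ) : min 1 t - max 0 (t - 1) = 1 - |t - 1| := by
  rcases le_total t 1 with h | h
  · rw [min_eq_right h, max_eq_left (by linarith), abs_of_nonpos (by linarith)]; ring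
  · rw [min_eq_left h, max_eq_right (by linarith), abs_of_nonneg (by linarith)]

/-- The overlap of two unit intervals has length `min 1 t - max 0 (t - 1)`, cut off at zero when
they are disjoint. -/
lemma ofReal_triangle (t : ℝ) :
    ENNReal.ofReal (triangle t) = volume (Icc (0 : ℝ) 1 ∩ Icc (t - 1) t) := by
  rw [Icc_inter_Icc, Real.volume_Icc, triangle, ENNReal.ofReal_max, ENNReal.ofReal_zero,
    max_eq_right zero_le]
  exact congrArg _ (min_sub_max_eq_one_sub_abs t).symm

/-- The triangular law: `1 + a - b` for `a`, `b` independent and uniform on `[0, 1]`. -/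
lemma lintegral_one_add_sub {G : ℝ → ENNReal} (hG : Measurable G) :
    ∫⁻ a in Icc (0 : ℝ) 1, ∫⁻ b in Icc (0 : ℝ) 1, G (1 + a - b) =
      ∫⁻ t, ENNReal.ofReal (triangle t) * G t := by
  have inner (a : ℝ) : ∫⁻ b in Icc (0 : ℝ) 1, G (1 + a - b) =
      ∫⁻ t, (Icc (0 : ℝ) 1).indicator 1 (1 + a - t) * G t := by
    rw [← lintegral_indicator measurableSet_Icc,
      ← lintegral_sub_left_eq_self (fun t => (Icc (0 : ℝ) 1).indicator 1 (1 + a - t) * G t) (1 + a)]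
    refine lintegral_congr fun b => ?_
    simp [indicator]
  have hind : Measurable ((Icc (0 : ℝ) 1).indicator (1 : ℝ → ENNReal)) :=
    measurable_one.indicator measurableSet_Icc
  simp_rw [inner]
  rw [lintegral_lintegral_swap (by fun_prop)]
  refine lintegral_congr fun t => ?_
  rw [lintegral_mul_const _ (by fun_prop), ofReal_triangle, inter_comm,
    ← Measure.restrict_apply' measurableSet_Icc, ← lintegral_indicator_one measurableSet_Icc]
  congr 1
  refine lintegral_congr fun a => ?_
  -- After substituting `t = 1 + a - b` and exchanging the integrals, the weight at `t` is the
  -- length of the set of admissible `a`.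
  have : (1 + a - t ∈ Icc (0 : ℝ) 1) ↔ a ∈ Icc (t - 1) t := by
    simp only [mem_Icc]; constructor <;> rintro ⟨h1, h2⟩ <;> constructor <;> linarith
  simp only [indicator, this, Pi.one_apply]

lemma lintegral_one_add_sub' {G : ℝ → ENNReal} (hG : Measurable G) :
    ∫⁻ b in Icc (0 : ℝ) 1, ∫⁻ a in Icc (0 : ℝ) 1, G (1 + a - b) =
      ∫⁻ t, ENNReal.ofReal (triangle t) * G t := by
  rw [← lintegral_one_add_sub hG, lintegral_lintegral_swap (by fun_prop)]

/-- The unit square. -/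
def unitSquare : Set (ℝ × ℝ) := Icc 0 1 ×ˢ Icc 0 1

/-- Differences of two independent uniform points of the unit square have the product of two
triangular laws. -/
lemma lintegral_unitSquare_prod {F : ℝ × ℝ → ENNReal} (hF : Measurable F) :
    ∫⁻ z, F (1 + z.2.1 - z.1.1, 1 + z.1.2 - z.2.2)
        ∂((volume.restrict unitSquare).prod (volume.restrict unitSquare)) =
      ∫⁻ z, ENNReal.ofReal (triangle z.1 * triangle z.2) * F z := by
  have hsq : (volume : Measure (ℝ × ℝ)).restrict unitSquare =
      (volume.restrict (Icc (0 : ℝ) 1)).prod (volume.restrict (Icc (0 : ℝ) 1)) := by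
    rw [Measure.prod_restrict]; rfl
  have ht : Measurable triangle := continuous_triangle.measurable
  rw [lintegral_prod _ (by fun_prop), hsq, lintegral_prod _ (by fun_prop)]
  have step (p₁ p₂ : ℝ) : ∫⁻ q, F (1 + q.1 - p₁, 1 + p₂ - q.2)
      ∂((volume.restrict (Icc (0 : ℝ) 1)).prod (volume.restrict (Icc (0 : ℝ) 1))) =
      ∫⁻ q₁ in Icc (0 : ℝ) 1, ∫⁻ q₂ in Icc (0 : ℝ) 1, F (1 + q₁ - p₁, 1 + p₂ - q₂) :=
    lintegral_prod _ (by fun_prop)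
  simp_rw [step]
  -- Exchanging `p₂` with `q₁` separates the pairs `(p₁, q₁)` and `(p₂, q₂)`, which determine `s`
  -- and `t` respectively.
  have swap (p₁ : ℝ) : ∫⁻ p₂ in Icc (0 : ℝ) 1, ∫⁻ q₁ in Icc (0 : ℝ) 1, ∫⁻ q₂ in Icc (0 : ℝ) 1,
      F (1 + q₁ - p₁, 1 + p₂ - q₂) =
      ∫⁻ q₁ in Icc (0 : ℝ) 1, ∫⁻ t, ENNReal.ofReal (triangle t) * F (1 + q₁ - p₁, t) := by
    rw [lintegral_lintegral_swap (Measurable.aemeasurable (by fun_prop))]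
    refine lintegral_congr fun q₁ => ?_
    exact lintegral_one_add_sub (G := fun t => F (1 + q₁ - p₁, t)) (by fun_prop)
  simp_rw [swap]
  rw [lintegral_one_add_sub' (G := fun s => ∫⁻ t, ENNReal.ofReal (triangle t) * F (s, t))
    (by fun_prop), Measure.volume_eq_prod, lintegral_prod _ (by fun_prop)]
  refine lintegral_congr fun s => ?_
  rw [← lintegral_const_mul _ (by fun_prop)]
  refine lintegral_congr fun t => ?_
  rw [ENNReal.ofReal_mul (triangle_nonneg _), mul_assoc]

/-! ### Passage to orthonormal and polar coordinates. -/

/-- The change from orthonormal to lattice coordinates. -/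
noncomputable def latticeCoord : ℝ × ℝ →ₗ[ℝ] ℝ × ℝ :=
  Matrix.toLin (Module.Basis.finTwoProd ℝ) (Module.Basis.finTwoProd ℝ) !![√3 / 3, 1; √3 / 3, -1]

lemma latticeCoord_apply (w : ℝ × ℝ) :
    latticeCoord w = (√3 / 3 * w.1 + w.2, √3 / 3 * w.1 - w.2) := by
  rw [latticeCoord, Matrix.toLin_finTwoProd_apply]
  simp [sub_eq_add_neg]

lemma det_latticeCoord : LinearMap.det latticeCoord = -(2 / √3) := by
  have h3 : √3 * √3 = 3 := Real.mul_self_sqrt (by norm_num)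
  rw [latticeCoord, LinearMap.det_toLin, Matrix.det_fin_two_of]
  field_simp
  linear_combination -2 * h3

lemma lintegral_latticeCoord {H : ℝ × ℝ → ENNReal} (hH : Measurable H) :
    ∫⁻ z, H z = ENNReal.ofReal (2 / √3) * ∫⁻ w, H (latticeCoord w) := by
  have h0 : LinearMap.det latticeCoord ≠ 0 := by
    rw [det_latticeCoord]; exact neg_ne_zero.2 (by positivity)
  have hm : Measurable latticeCoord := latticeCoord.continuous_of_finiteDimensional.measurable
  rw [← lintegral_map hH hm, Measure.map_linearMap_addHaar_eq_smul_addHaar _ h0,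
    lintegral_smul_measure, det_latticeCoord, smul_eq_mul, ← mul_assoc,
    ← ENNReal.ofReal_mul (by positivity), abs_inv, abs_neg, abs_of_nonneg (by positivity),
    mul_inv_cancel₀ (by positivity), ENNReal.ofReal_one, one_mul]

/-- Below `-π/6` the first coordinate is nonpositive, above `π/6` the second; either way one tent
vanishes. -/
lemma lintegral_angle {r : ℝ} (hr : 0 ≤ r) :
    ∫⁻ θ in Ioo (-Real.pi) Real.pi,
        ENNReal.ofReal (triangle (fstCoord r θ) * triangle (sndCoord r θ)) =
      ENNReal.ofReal (angleIntegral r) := by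
  have hπ := Real.pi_pos
  have hsub : Ioc (-(Real.pi / 6)) (Real.pi / 6) ⊆ Ioo (-Real.pi) Real.pi := by
    rintro x ⟨h1, h2⟩; constructor <;> linarith
  rw [angleIntegral, intervalIntegral.integral_of_le (by linarith),
    ofReal_integral_eq_lintegral_ofReal
      ((intervalIntegrable_iff_integrableOn_Ioc_of_le (by linarith)).1
        (intervalIntegrable_triangle_mul _ _ _))
      (Filter.Eventually.of_forall fun _ => mul_nonneg (triangle_nonneg _) (triangle_nonneg _)),
    ← lintegral_indicator measurableSet_Ioo, ← lintegral_indicator measurableSet_Ioc]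
  refine lintegral_congr fun θ => ?_
  by_cases h : θ ∈ Ioc (-(Real.pi / 6)) (Real.pi / 6)
  · rw [indicator_of_mem h, indicator_of_mem (hsub h)]
  · rw [indicator_of_notMem h]
    by_cases h' : θ ∈ Ioo (-Real.pi) Real.pi
    · rw [indicator_of_mem h']
      rw [mem_Ioc, not_and_or, not_lt, not_le] at h
      rcases h with h | h
      · rw [triangle_of_nonpos (fstCoord_nonpos hr h'.1.le h), zero_mul, ENNReal.ofReal_zero]
      · rw [← fstCoord_neg, triangle_of_nonpos (s := fstCoord r (-θ))
          (fstCoord_nonpos hr (by linarith [h'.2]) (by linarith)), mul_zero, ENNReal.ofReal_zero]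
    · rw [indicator_of_notMem h']

/-- The quadratic form of the squared distance in lattice coordinates. -/
def latticeForm (z : ℝ × ℝ) : ℝ := z.1 ^ 2 + z.1 * z.2 + z.2 ^ 2

/-- The law of the length of a vector with triangular lattice coordinates. -/
lemma lintegral_sqrt_latticeForm {F : ℝ → ENNReal} (hF : Measurable F) :
    ∫⁻ z : ℝ × ℝ, ENNReal.ofReal (triangle z.1 * triangle z.2) * F √(latticeForm z) =
      ∫⁻ r, ENNReal.ofReal (densityIJ r) * F r := by
  have ht : Measurable triangle := continuous_triangle.measurable
  have h3 : √3 * √3 = 3 := Real.mul_self_sqrt (by norm_num)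
  have hform (w : ℝ × ℝ) : latticeForm (latticeCoord w) = w.1 ^ 2 + w.2 ^ 2 := by
    rw [latticeCoord_apply, latticeForm]
    linear_combination (w.1 ^ 2 / 3) * h3
  have hmf : Measurable latticeForm := by unfold latticeForm; fun_prop
  rw [lintegral_latticeCoord (by fun_prop), ← lintegral_comp_polarCoord_symm, polarCoord_target,
    Measure.volume_eq_prod, ← Measure.prod_restrict]
  have hcoord : Measurable fun p : ℝ × ℝ => triangle (fstCoord p.1 p.2) *
      triangle (sndCoord p.1 p.2) := by
    unfold fstCoord sndCoord; fun_prop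
  have hpolar : ∀ p ∈ Ioi (0 : ℝ) ×ˢ Ioo (-Real.pi) Real.pi, ENNReal.ofReal p.1 •
      (ENNReal.ofReal (triangle (latticeCoord (polarCoord.symm p)).1 *
        triangle (latticeCoord (polarCoord.symm p)).2) *
          F √(latticeForm (latticeCoord (polarCoord.symm p)))) =
      ENNReal.ofReal p.1 * F p.1 *
        ENNReal.ofReal (triangle (fstCoord p.1 p.2) * triangle (sndCoord p.1 p.2)) := by
    rintro ⟨r, θ⟩ ⟨hr, -⟩
    have hr' : 0 < r := hr
    have hlen : (r * Real.cos θ) ^ 2 + (r * Real.sin θ) ^ 2 = r ^ 2 := by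
      linear_combination r ^ 2 * Real.sin_sq_add_cos_sq θ
    rw [hform, latticeCoord_apply]
    simp only [polarCoord_symm_apply, hlen, Real.sqrt_sq hr'.le, smul_eq_mul, fstCoord, sndCoord]
    ring
  rw [Measure.prod_restrict, setLIntegral_congr_fun (by measurability) hpolar,
    ← Measure.prod_restrict, lintegral_prod _ (by fun_prop)]
  have hinner : ∀ r ∈ Ioi (0 : ℝ), ∫⁻ θ in Ioo (-Real.pi) Real.pi, ENNReal.ofReal r * F r *
        ENNReal.ofReal (triangle (fstCoord r θ) * triangle (sndCoord r θ)) =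
      ENNReal.ofReal r * F r * ENNReal.ofReal (angleIntegral r) := by
    intro r hr
    rw [lintegral_const_mul _ (by fun_prop), lintegral_angle (le_of_lt hr)]
  rw [setLIntegral_congr_fun measurableSet_Ioi hinner,
    ← lintegral_const_mul' _ _ ENNReal.ofReal_ne_top, ← lintegral_indicator measurableSet_Ioi]
  refine lintegral_congr fun r => ?_
  rcases lt_or_ge 0 r with hr | hr
  · rw [indicator_of_mem (mem_Ioi.2 hr), densityIJ_of_nonneg hr.le,
      show 2 * r * (angleIntegral r / √3) = 2 / √3 * (r * angleIntegral r) by ring,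
      ENNReal.ofReal_mul (by positivity), ENNReal.ofReal_mul hr.le]
    ring
  · have h0 : densityIJ r = 0 := by
      rcases hr.lt_or_eq with h | h
      · exact densityIJ_of_neg h
      · simp [densityIJ, h]
    rw [indicator_of_notMem (notMem_Ioi.2 hr), h0, ENNReal.ofReal_zero, zero_mul]

/-! ### Uniform laws on the rhombuses. -/

/-- The linear parametrisation of the plane by the two sides of the top rhombus at `0`. -/
noncomputable def sideMap : (ℝ × ℝ) ≃ₗ[ℝ] Plane where
  toFun p := !₂[√3 / 2 * (p.1 - p.2), (p.1 + p.2) / 2]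
  map_add' p q := by
    ext i; fin_cases i <;> simp <;> ring
  map_smul' r p := by
    ext i; fin_cases i <;> simp <;> ring
  invFun x := (√3 / 3 * x 0 + x 1, x 1 - √3 / 3 * x 0)
  left_inv p := by
    have h3 : √3 * √3 = 3 := Real.mul_self_sqrt (by norm_num)
    ext
    · simp; linear_combination (p.1 - p.2) / 6 * h3
    · simp; linear_combination -(p.1 - p.2) / 6 * h3
  right_inv x := by
    have h3 : √3 * √3 = 3 := Real.mul_self_sqrt (by norm_num)
    ext i
    fin_cases i
    · simp; linear_combination x 0 / 3 * h3
    · simp; ring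

/-- The affine parametrisation carrying the unit square to the top rhombus at `c`. -/
noncomputable def rhombusMap (c : Plane) : (ℝ × ℝ) ≃ᵃ[ℝ] Plane :=
  sideMap.toAffineEquiv.trans (AffineEquiv.constVAdd ℝ Plane c)

lemma rhombusMap_apply (c : Plane) (p : ℝ × ℝ) :
    rhombusMap c p = c + !₂[√3 / 2 * (p.1 - p.2), (p.1 + p.2) / 2] := rfl

lemma unitSquare_eq_convexHull : unitSquare = convexHull ℝ (({0, 1} : Set ℝ) ×ˢ {0, 1}) := by
  rw [convexHull_prod, convexHull_pair, segment_eq_Icc zero_le_one, unitSquare]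

/-- The square is the hull of its corners, affine maps commute with convex hulls, and the corners go
to the centre and its three vertices. -/
lemma rhombusMap_image_unitSquare (c : Plane) : rhombusMap c '' unitSquare = unitRhombus c 0 := by
  have h1 : Real.cos (Real.pi / 6 + 1 * (Real.pi / 3)) = 0 := by
    rw [show Real.pi / 6 + 1 * (Real.pi / 3) = Real.pi / 2 by ring, Real.cos_pi_div_two]
  have h2 : Real.sin (Real.pi / 6 + 1 * (Real.pi / 3)) = 1 := by
    rw [show Real.pi / 6 + 1 * (Real.pi / 3) = Real.pi / 2 by ring, Real.sin_pi_div_two]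
  have h3 : Real.cos (Real.pi / 6 + 2 * (Real.pi / 3)) = -(√3 / 2) := by
    rw [← Real.cos_pi_div_six, ← Real.cos_pi_sub]; congr 1; ring
  have h4 : Real.sin (Real.pi / 6 + 2 * (Real.pi / 3)) = 1 / 2 := by
    rw [← Real.sin_pi_div_six, ← Real.sin_pi_sub]; congr 1; ring
  have v0 : hexVertex c 0 = rhombusMap c (1, 0) := by
    simp [hexVertex, rhombusMap_apply]
  have v1 : hexVertex c (0 + 1) = rhombusMap c (1, 1) := by
    simp only [hexVertex, rhombusMap_apply, zero_add, Nat.cast_one, h1, h2]; norm_num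
  have v2 : hexVertex c (0 + 2) = rhombusMap c (0, 1) := by
    simp only [hexVertex, rhombusMap_apply, zero_add, Nat.cast_ofNat, h3, h4]; simp
  have vc : c = rhombusMap c (0, 0) := by
    have : !₂[(0 : ℝ), 0] = 0 := by ext i; fin_cases i <;> rfl
    simp [rhombusMap_apply, this]
  have hc : unitRhombus c 0 = convexHull ℝ
      {rhombusMap c (0, 0), rhombusMap c (1, 0), rhombusMap c (1, 1), rhombusMap c (0, 1)} := by
    rw [unitRhombus, v0, v1, v2, ← vc]
  have himg := AffineMap.image_convexHull (rhombusMap c : (ℝ × ℝ) →ᵃ[ℝ] Plane)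
    (({0, 1} : Set ℝ) ×ˢ {0, 1})
  rw [AffineEquiv.coe_toAffineMap] at himg
  rw [unitSquare_eq_convexHull, himg, hc]
  congr 1
  simp only [insert_prod, singleton_prod, image_union, image_insert_eq, image_singleton]
  ext x
  simp only [mem_union, mem_insert_iff, mem_singleton_iff]
  tauto

/-- Affine equivalences map a set of unit measure with its volume to the uniform law of
the image. -/
lemma cond_image_affineEquiv (g : (ℝ × ℝ) ≃ᵃ[ℝ] Plane) {s : Set (ℝ × ℝ)} (hs : volume s = 1) :
    ProbabilityTheory.cond (volume : Measure Plane) (g '' s) =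
      (volume.restrict s).map g := by
  let e : (ℝ × ℝ) ≃L[ℝ] Plane := g.linear.toContinuousLinearEquiv
  have hg : ⇑g = (fun x => x + g 0) ∘ e := by
    ext1 x
    have := g.map_vadd 0 x
    simp only [vadd_eq_add, add_zero] at this
    exact this
  have hme : MeasurableEmbedding g := by
    rw [hg]
    exact (measurableEmbedding_addRight (g 0)).comp e.toHomeomorph.measurableEmbedding
  have hmap : (volume : Measure (ℝ × ℝ)).map g = (volume : Measure (ℝ × ℝ)).map e := by
    have : ((volume : Measure (ℝ × ℝ)).map e).IsAddHaarMeasure :=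
      e.isAddHaarMeasure_map volume
    rw [hg, ← Measure.map_map (by fun_prop) e.continuous.measurable]
    exact map_add_right_eq_self _ _
  have : ((volume : Measure (ℝ × ℝ)).map e).IsAddHaarMeasure := e.isAddHaarMeasure_map volume
  -- By uniqueness of Haar measure the pushforward is a multiple of Lebesgue measure. The constant
  -- need not be computed: total mass one fixes it.
  obtain ⟨k, hk⟩ : ∃ k : ENNReal, (volume : Measure (ℝ × ℝ)).map e = k • (volume : Measure Plane) :=
    ⟨_, Measure.isAddLeftInvariant_eq_smul _ _⟩
  have hrestr : (volume.restrict s).map g = k • volume.restrict (g '' s) := by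
    rw [← Measure.restrict_smul, ← hk, ← hmap, hme.restrict_map, preimage_image_eq _ g.injective]
  have hone : k * volume (g '' s) = 1 := by
    have := congrArg (fun μ : Measure Plane => μ univ) hrestr
    simpa [Measure.map_apply hme.measurable MeasurableSet.univ, hs] using this.symm
  rw [ProbabilityTheory.cond, hrestr, ENNReal.eq_inv_of_mul_eq_one_left hone]

lemma volume_unitSquare : volume unitSquare = 1 := by
  rw [unitSquare, Measure.volume_eq_prod, Measure.prod_prod]; simp

/-- The cross term is `+st` because the sides at the centre have inner product `-1/2` and `t`
multiplies the opposite of the second side. -/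
lemma dist_rhombusMap (p q : ℝ × ℝ) :
    dist (rhombusMap centerLeft p) (rhombusMap centerRight q) =
      √(latticeForm (1 + q.1 - p.1, 1 + p.2 - q.2)) := by
  have h3 : √3 * √3 = 3 := Real.mul_self_sqrt (by norm_num)
  rw [EuclideanSpace.dist_eq, Fin.sum_univ_two, Real.dist_eq, Real.dist_eq, sq_abs, sq_abs]
  congr 1
  simp [rhombusMap_apply, centerLeft, centerRight, latticeForm]
  linear_combination ((p.1 - p.2) / 2 - 1 - (q.1 - q.2) / 2) ^ 2 * h3

/-! ### The law of the distance. -/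

lemma measurable_densityIJ : Measurable densityIJ := by
  have ha : Measurable Real.arcsin := Real.continuous_arcsin.measurable
  unfold densityIJ piece1 piece2 piece3 piece4 piece5
  refine Measurable.mul (by fun_prop) ?_
  refine Measurable.ite measurableSet_Iio (by fun_prop) ?_
  iterate 5 refine Measurable.ite measurableSet_Iic (by fun_prop) ?_
  fun_prop

lemma map_dist_eq_withDensity {Ω : Type*} [MeasurableSpace Ω] {P : Measure Ω}
    [IsProbabilityMeasure P] (φ : Plane ≃ᵃⁱ[ℝ] Plane) {X Y : Ω → Plane}
    (hX : pdf.IsUniform X (φ '' rhombusI) P volume)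
    (hY : pdf.IsUniform Y (φ '' rhombusJ) P volume) (hXY : IndepFun X Y P) :
    AEMeasurable (fun ω => dist (X ω) (Y ω)) P ∧
      P.map (fun ω => dist (X ω) (Y ω)) =
        volume.withDensity fun d => ENNReal.ofReal (densityIJ d) := by
  have law {Z : Ω → Plane} {c : Plane}
      (hZ : pdf.IsUniform Z (φ '' unitRhombus c 0) P volume) : AEMeasurable Z P ∧
        P.map Z = (volume.restrict unitSquare).map (fun p => φ (rhombusMap c p)) := by
    have himg : φ '' unitRhombus c 0 = ((rhombusMap c).trans φ.toAffineEquiv) '' unitSquare := by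
      rw [← rhombusMap_image_unitSquare, image_image]; rfl
    have hmap : P.map Z = (volume.restrict unitSquare).map (fun p => φ (rhombusMap c p)) := by
      rw [hZ, himg, cond_image_affineEquiv _ volume_unitSquare]; rfl
    refine ⟨?_, hmap⟩
    -- The pushforward by a map that is not a.e. measurable is zero by convention, whereas the
    -- uniform law has mass one.
    by_contra h
    have hm : Measurable fun p => φ (rhombusMap c p) :=
      φ.continuous.measurable.comp (rhombusMap c).continuous_of_finiteDimensional.measurable
    rw [Measure.map_of_not_aemeasurable h] at hmap
    have := congrArg (fun μ : Measure Plane => μ univ) hmap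
    simp [Measure.map_apply hm MeasurableSet.univ, volume_unitSquare] at this
  obtain ⟨hXm, hXl⟩ := law hX
  obtain ⟨hYm, hYl⟩ := law hY
  have hm (c : Plane) : Measurable fun p => φ (rhombusMap c p) :=
    φ.continuous.measurable.comp (rhombusMap c).continuous_of_finiteDimensional.measurable
  have hD : AEMeasurable (fun ω => dist (X ω) (Y ω)) P := hXm.dist hYm
  refine ⟨hD, ?_⟩
  have : IsFiniteMeasure ((volume : Measure (ℝ × ℝ)).restrict unitSquare) :=
    ⟨by simp [volume_unitSquare]⟩
  have hjoint : P.map (fun ω => dist (X ω) (Y ω)) =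
      ((volume.restrict unitSquare).prod (volume.restrict unitSquare)).map
        (fun z : (ℝ × ℝ) × ℝ × ℝ => √(latticeForm (1 + z.2.1 - z.1.1, 1 + z.1.2 - z.2.2))) := by
    have hdist : Measurable fun z : Plane × Plane => dist z.1 z.2 := by fun_prop
    have hcomp : P.map (fun ω => dist (X ω) (Y ω)) =
        (P.map fun ω => (X ω, Y ω)).map fun z => dist z.1 z.2 :=
      (AEMeasurable.map_map_of_aemeasurable hdist.aemeasurable (hXm.prodMk hYm)).symm
    rw [hcomp, (indepFun_iff_map_prod_eq_prod_map_map hXm hYm).1 hXY, hXl, hYl,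
      Measure.map_prod_map _ _ (hm _) (hm _), Measure.map_map hdist ((hm _).prodMap (hm _))]
    congr 1
    ext z
    simp [φ.dist_map, dist_rhombusMap]
  have hlf : Measurable latticeForm := by unfold latticeForm; fun_prop
  -- Measures are compared on a measurable set by applying the integral formulas to its indicator.
  ext B hB
  have hF : Measurable (B.indicator (1 : ℝ → ENNReal)) := measurable_one.indicator hB
  rw [← lintegral_indicator_one hB, hjoint, lintegral_map hF (by fun_prop),
    lintegral_unitSquare_prod (F := fun z => B.indicator 1 √(latticeForm z)) (by fun_prop),
    lintegral_sqrt_latticeForm hF, withDensity_apply _ hB, ← lintegral_indicator hB]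
  refine lintegral_congr fun r => ?_
  by_cases h : r ∈ B <;> simp [h]

end HexRhombus

theorem mainTheorem6 :
    -- the value of the function on each of the five closed intervals, and outside of them
    (∀ d ∈ Icc (0 : ℝ) 1, HexRhombus.densityIJ d = 2 * d * HexRhombus.piece1 d) ∧
    (∀ d ∈ Icc (1 : ℝ) (√3), HexRhombus.densityIJ d = 2 * d * HexRhombus.piece2 d) ∧
    (∀ d ∈ Icc (√3) (2 : ℝ), HexRhombus.densityIJ d = 2 * d * HexRhombus.piece3 d) ∧
    (∀ d ∈ Icc (2 : ℝ) (√7), HexRhombus.densityIJ d = 2 * d * HexRhombus.piece4 d) ∧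
    (∀ d ∈ Icc (√7) (2 * √3), HexRhombus.densityIJ d = 2 * d * HexRhombus.piece5 d) ∧
    (∀ d ∉ Icc (0 : ℝ) (2 * √3), HexRhombus.densityIJ d = 0) ∧
    (∀ d, 0 ≤ HexRhombus.densityIJ d) ∧
    -- it is the density of the distance, for every congruent copy of the configuration
    (∀ {Ω : Type*} [MeasurableSpace Ω] (P : Measure Ω) [IsProbabilityMeasure P]
      (φ : HexRhombus.Plane ≃ᵃⁱ[ℝ] HexRhombus.Plane) (X Y : Ω → HexRhombus.Plane),
      pdf.IsUniform X (φ '' HexRhombus.rhombusI) P volume →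
      pdf.IsUniform Y (φ '' HexRhombus.rhombusJ) P volume →
      IndepFun X Y P →
        HasPDF (fun ω => dist (X ω) (Y ω)) P volume ∧
        pdf (fun ω => dist (X ω) (Y ω)) P volume
          =ᵐ[volume] fun d => ENNReal.ofReal (HexRhombus.densityIJ d)) := by
  open HexRhombus in
  have h3 : 0 < √3 := by positivity
  have h7 : 0 < √7 := by positivity
  refine ⟨?_, ?_, ?_, ?_, ?_, ?_, densityIJ_nonneg, ?_⟩
  · rintro d ⟨h1, h2⟩
    exact densityIJ_of_angleIntegral_eq h1 (angleIntegral_piece1 h1 h2)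
  · rintro d ⟨h1, h2⟩
    exact densityIJ_of_angleIntegral_eq (by linarith) (angleIntegral_piece2 h1 h2)
  · rintro d ⟨h1, h2⟩
    exact densityIJ_of_angleIntegral_eq (by linarith) (angleIntegral_piece3 h1 h2)
  · rintro d ⟨h1, h2⟩
    exact densityIJ_of_angleIntegral_eq (by linarith) (angleIntegral_piece4 h1 h2)
  · rintro d ⟨h1, h2⟩
    exact densityIJ_of_angleIntegral_eq (by linarith) (angleIntegral_piece5 h1 h2)
  · intro d hd
    rcases lt_or_ge d 0 with h | h
    · exact densityIJ_of_neg h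
    · have h' : 2 * √3 < d := not_le.1 fun hle => hd ⟨h, hle⟩
      rw [densityIJ_of_nonneg h, angleIntegral_of_le h'.le, zero_div, mul_zero]
  · intro Ω _ P _ φ X Y hX hY hXY
    obtain ⟨hD, hmap⟩ := map_dist_eq_withDensity φ hX hY hXY
    have hf : AEMeasurable (fun d => ENNReal.ofReal (densityIJ d)) volume :=
      measurable_densityIJ.ennreal_ofReal.aemeasurable
    have := hasPDF_of_map_eq_withDensity hD _ hf hmap
    exact ⟨this, (pdf.eq_of_map_eq_withDensity _ hf).1 hmap⟩
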